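/- Let $\mathbb{T}^2=\mathbb{R}^2/\mathbb{Z}^2$ be the flat torus with Lebesgue measure, and for $\epsilon>0$ let $\Omega_\epsilon=B(0,\epsilon)\subset\mathbb{T}^2$ be the open ball of radius $\epsilon$ about $0$ for the flat metric. For $\lambda\in\mathbb{R}$ and $u_0\in L^2(\mathbb{T}^2)$ (complex-valued) let $$\Pi_\lambda u_0=\sum_{(p,q)\in\mathbb{Z}^2,\ 2\pi\sqrt{p^2+q^2}=\lambda}\langle u_0,\varphi_{p,q}\rangle_{L^2(\mathbb{T}^2)}\,\varphi_{p,q},\qquad \varphi_{p,q}(x,y)=e^{2\pi i(px+qy)},$$ that is, $\Pi_\lambda$ is the orthogonal projection onto the eigenspace of $\sqrt{-\Delta}$ for the eigenvalue $\lambda$ (and $\Pi_\lambda=0$ if $\lambda$ is not an eigenvalue). Then there exists a constant $C>0$ such that for all $0<\epsilon<e^{-1}$, all $\lambda\le\epsilon^{-17}$ and all $u_0\in L^2(\mathbb{T}^2)$, $$\|\Pi_\lambda u_0\|_{L^2(\mathbb{T}^2)}^2\le \exp\exp\left(\frac{C\log\epsilon^{-1}}{\log\log\epsilon^{-1}}\right)\|\Pi_\lambda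 u_0\|_{L^2(\Omega_\epsilon)}^2 .$$ -/

import Mathlib

namespace TorusLowFreq

open MeasureTheory

noncomputable section

/-- The flat torus `𝕋² = ℝ² / ℤ²`, with its Lebesgue measure `volume` (of total mass `1`). -/
abbrev Torus : Type := UnitAddTorus (Fin 2)

/-- The complex Hilbert space `L²(𝕋²)`. -/
abbrev L2Torus : Type := Lp ℂ 2 (volume : Measure Torus)

/-- The exponential `(x, y) ↦ exp (2πi (p x + q y))`, `n = (p, q)`, as an element of `L²(𝕋²)`. -/
def expMode (n : Fin 2 → ℤ) : L2Torus :=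
  ContinuousMap.toLp (E := ℂ) 2 (volume : Measure Torus) ℂ (UnitAddTorus.mFourier n)

/-- The frequencies `(p, q) ∈ ℤ²` with `2π √(p² + q²) = l`, i.e. those whose exponential is an
eigenfunction of `√(-Δ)` with eigenvalue `l`. -/
def freqSet (l : ℝ) : Set (Fin 2 → ℤ) :=
  {n | 2 * Real.pi * Real.sqrt ((n 0 : ℝ) ^ 2 + (n 1 : ℝ) ^ 2) = l}

theorem freqSet_finite (l : ℝ) : (freqSet l).Finite := by
  refine (Set.finite_Icc (fun _ : Fin 2 => -⌈l⌉) (fun _ => ⌈l⌉)).subset ?_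
  intro n hn
  have hn' : 2 * Real.pi * Real.sqrt ((n 0 : ℝ) ^ 2 + (n 1 : ℝ) ^ 2) = l := hn
  have key : ∀ i, |n i| ≤ ⌈l⌉ := by
    intro i
    have h1 : |(n i : ℝ)| ≤ Real.sqrt ((n 0 : ℝ) ^ 2 + (n 1 : ℝ) ^ 2) := by
      apply Real.abs_le_sqrt
      fin_cases i
      · exact le_add_of_nonneg_right (sq_nonneg _)
      · exact le_add_of_nonneg_left (sq_nonneg _)
    have h2 : |(n i : ℝ)| ≤ l := by
      nlinarith [Real.pi_gt_three, Real.sqrt_nonneg ((n 0 : ℝ) ^ 2 + (n 1 : ℝ) ^ 2)]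
    have h3 : ((|n i| : ℤ) : ℝ) ≤ (⌈l⌉ : ℝ) := by
      push_cast
      exact h2.trans (Int.le_ceil l)
    exact_mod_cast h3
  exact ⟨fun i => (abs_le.mp (key i)).1, fun i => (abs_le.mp (key i)).2⟩

/-- The spectral projector `Π_l u = ∑ ⟨u, φ⟩ φ`, the sum over the exponentials `φ` that are
eigenfunctions of `√(-Δ)` with eigenvalue `l`. -/
def specProj (l : ℝ) (u : L2Torus) : L2Torus :=
  ∑ n ∈ (freqSet_finite l).toFinset, (inner ℂ (expMode n) u : ℂ) • expMode n

/-- The open ball `B(0, ε) ⊆ 𝕋²` of the flat metric. The norm on `ℝ / ℤ` is the distance to the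
nearest integer. -/
def smallBall (ε : ℝ) : Set Torus :=
  {x | Real.sqrt (‖x 0‖ ^ 2 + ‖x 1‖ ^ 2) < ε}

end

end TorusLowFreq

/-!
For a frequency `n` in the spectrum of `Π_l u`, the Gaussian integer `n 0 + n 1 * i` has norm
`m = (l / 2π)²`, hence divides `m`. The divisor bound in the factorial ring `ℤ[i]` therefore leaves
at most `N = exp (O (L / log L))` frequencies, where `L = log ε⁻¹` and `log m = O (L)`: a prime of
norm at least `√L` and exponent `a` contributes a factor `a + 1 ≤ 2 ^ a`, bounded by a small power
of the norm, and there are only `O (√L)` smaller primes.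

A coefficient of a sum of `N` characters is recovered from the values of the sum on a small ball by
removing the other frequencies one at a time. If `χ` is a character and `h` a small translation,
`f ↦ f (· + h) - χ h • f` annihilates `χ`, at most doubles the `L^p` norm up to enlarging the ball
by `|h|`, and multiplies the coefficient of `ψ` by `ψ h - χ h`. For distinct characters of the torus
some `h` of length at most `δ` makes this multiplier at least `4 * δ`. With `δ = ε / 2N`, all `N`
steps take place in the ball of radius `ε`, and their total cost `(2N / ε) ^ N` has the desired
double exponential form.
-/

namespace TorusLowFreq

open MeasureTheory UniqueFactorizationMonoid
open scoped Finset ENNReal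

noncomputable section

section DivisorBound

theorem one_add_natCast_le_mul_rpow_pow {η x : ℝ} (hη : 0 < η) (hx : 2 ≤ x) (a : ℕ) :
    1 + (a : ℝ) ≤ (1 + 1 / (η * Real.log 2)) * (x ^ a) ^ η := by
  have hb : 0 < η * Real.log 2 := mul_pos hη (Real.log_pos one_lt_two)
  have hpow : 1 + η * Real.log 2 * a ≤ (x ^ a) ^ η :=
    calc 1 + η * Real.log 2 * a ≤ Real.exp (Real.log ((2 : ℝ) ^ a) * η) := by
          rw [Real.log_pow]
          linarith [Real.add_one_le_exp ((a : ℝ) * Real.log 2 * η)]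
      _ = ((2 : ℝ) ^ a) ^ η := (Real.rpow_def_of_pos (by positivity) η).symm
      _ ≤ (x ^ a) ^ η := by gcongr
  calc 1 + (a : ℝ) ≤ (1 + 1 / (η * Real.log 2)) * (1 + η * Real.log 2 * a) := by
        have hinv : 1 / (η * Real.log 2) * (η * Real.log 2) = 1 := one_div_mul_cancel hb.ne'
        have hinv0 : 0 ≤ 1 / (η * Real.log 2) := by positivity
        have hba : 0 ≤ η * Real.log 2 * a := by positivity
        linear_combination hinv0 + hba - (a : ℝ) * hinv
    _ ≤ _ := by gcongr

theorem one_add_natCast_le_rpow_pow {η x : ℝ} (hx : 0 ≤ x) (hxη : 2 ≤ x ^ η) (a : ℕ) :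
    1 + (a : ℝ) ≤ (x ^ a) ^ η :=
  calc 1 + (a : ℝ) ≤ 2 ^ a := by exact_mod_cast (add_comm 1 a).trans_le Nat.lt_two_pow_self
    _ ≤ (x ^ η) ^ a := by gcongr
    _ = (x ^ a) ^ η := Real.rpow_pow_comm hx η a

theorem prod_count_add_one_le {α : Type*} [DecidableEq α] {M : Multiset α} {ν : α → ℝ}
    (hν : ∀ p ∈ M, 2 ≤ ν p) {η : ℝ} (hη : 0 < η) :
    ∏ p ∈ M.toFinset, ((M.count p : ℝ) + 1) ≤
      (1 + 1 / (η * Real.log 2)) ^ #{p ∈ M.toFinset | ν p ^ η < 2} * (M.map ν).prod ^ η := by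
  have hν0 : ∀ p ∈ M.toFinset, 0 ≤ ν p := fun p hp =>
    zero_le_two.trans (hν p (Multiset.mem_toFinset.1 hp))
  calc ∏ p ∈ M.toFinset, ((M.count p : ℝ) + 1)
      ≤ ∏ p ∈ M.toFinset, (if ν p ^ η < 2 then 1 + 1 / (η * Real.log 2) else 1) *
          (ν p ^ M.count p) ^ η := by
        refine Finset.prod_le_prod (fun p _ => by positivity) fun p hp => ?_
        rw [add_comm]
        split_ifs with hsmall
        · exact one_add_natCast_le_mul_rpow_pow hη (hν p (Multiset.mem_toFinset.1 hp)) _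
        · rw [one_mul]
          exact one_add_natCast_le_rpow_pow (hν0 p hp) (not_lt.1 hsmall) _
    _ = _ := by
        rw [Finset.prod_mul_distrib, Finset.prod_ite, Finset.prod_const, Finset.prod_const_one,
          mul_one, Real.finsetProd_rpow _ _ fun p hp => pow_nonneg (hν0 p hp) _,
          ← Finset.prod_multiset_map_count]

variable {α : Type*} [CommMonoidWithZero α] [UniqueFactorizationMonoid α] [Finite αˣ]

theorem card_le_card_units_mul_of_forall_dvd [NormalizationMonoid α] [DecidableEq α] {w : α}
    (hw : w ≠ 0) {S : Finset α} (hS : ∀ z ∈ S, z ∣ w) :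
    #S ≤ Nat.card αˣ *
      ∏ p ∈ (normalizedFactors w).toFinset, ((normalizedFactors w).count p + 1) := by
  have hne : ∀ z ∈ S, z ≠ 0 := fun z hz => ne_zero_of_dvd_ne_zero hw (hS z hz)
  rw [← Multiset.card_Iic]
  refine Finset.card_le_mul_card_image_of_maps_to (f := normalizedFactors) (fun z hz => ?_) _
    fun M _ => ?_
  · exact Finset.mem_Iic.2
      ((dvd_iff_normalizedFactors_le_normalizedFactors (hne z hz) hw).1 (hS z hz))
  · obtain hempty | ⟨v, hv⟩ := Finset.eq_empty_or_nonempty {z ∈ S | normalizedFactors z = M}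
    · simp [hempty]
    have := Fintype.ofFinite αˣ
    rw [Finset.mem_filter] at hv
    have hassoc : {z ∈ S | normalizedFactors z = M} ⊆
        Finset.univ.image fun u : αˣ => v * u := by
      intro z hz
      rw [Finset.mem_filter] at hz
      obtain ⟨u, hu⟩ := (associated_iff_normalizedFactors_eq_normalizedFactors
        (hne v hv.1) (hne z hz.1)).2 (hv.2.trans hz.2.symm)
      exact Finset.mem_image.2 ⟨u, Finset.mem_univ u, hu⟩
    rw [Nat.card_eq_fintype_card]
    exact (Finset.card_le_card hassoc).trans Finset.card_image_le

theorem card_le_mul_rpow_of_forall_dvd (ν : α →* ℕ) (hν : ∀ p, Prime p → 2 ≤ ν p) {η : ℝ}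
    (hη : 0 < η) {P : Finset α} (hP : ∀ p, Prime p → (ν p : ℝ) ^ η < 2 → p ∈ P) {w : α}
    (hw : w ≠ 0) {S : Finset α} (hS : ∀ z ∈ S, z ∣ w) :
    (#S : ℝ) ≤ Nat.card αˣ * ((1 + 1 / (η * Real.log 2)) ^ #P * (ν w : ℝ) ^ η) := by
  classical
  let _ : NormalizationMonoid α :=
    (UniqueFactorizationMonoid.strongNormalizationMonoid (α := α)).toNormalizationMonoid
  set M := normalizedFactors w
  have hprime : ∀ p ∈ M, Prime p := fun p hp => prime_of_normalized_factor p hp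
  have hνw : (M.map fun p => (ν p : ℝ)).prod = ν w := by
    rw [← associated_iff_eq.1 ((prod_normalizedFactors hw).map ν), map_multiset_prod,
      Nat.cast_multiset_prod, Multiset.map_map]
    rfl
  have hsmall : {p ∈ M.toFinset | (ν p : ℝ) ^ η < 2} ⊆ P := fun p hp => by
    rw [Finset.mem_filter, Multiset.mem_toFinset] at hp
    exact hP p (hprime p hp.1) hp.2
  have hbase : 1 ≤ 1 + 1 / (η * Real.log 2) := by
    have := Real.log_pos one_lt_two
    exact le_add_of_nonneg_right (by positivity)
  have hdiv : (#S : ℝ) ≤ Nat.card αˣ * ∏ p ∈ M.toFinset, ((M.count p : ℝ) + 1) := by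
    exact_mod_cast card_le_card_units_mul_of_forall_dvd hw hS
  have hcount := prod_count_add_one_le (M := M) (ν := fun p => (ν p : ℝ))
    (fun p hp => by exact_mod_cast hν p (hprime p hp)) hη
  rw [hνw] at hcount
  refine hdiv.trans (mul_le_mul_of_nonneg_left (hcount.trans ?_) (Nat.cast_nonneg _))
  gcongr

end DivisorBound

section LogEstimates

variable {L : ℝ}

theorem one_le_div_log (hL : 1 < L) : 1 ≤ L / Real.log L := by
  rw [one_le_div (Real.log_pos hL)]
  linarith [Real.log_le_sub_one_of_pos (zero_lt_one.trans hL)]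

theorem log_mul_sqrt_le (hL : 1 < L) : Real.log L * √L ≤ 16 * (L / Real.log L) := by
  have hL0 : 0 ≤ L := by linarith
  have hlog : Real.log L ≤ 4 * √√L := by
    have := Real.log_le_rpow_div hL0 (by norm_num : (0 : ℝ) < 1 / 4)
    rw [Real.sqrt_eq_rpow, Real.sqrt_eq_rpow, ← Real.rpow_mul hL0]
    norm_num at this ⊢
    linarith
  rw [mul_div_assoc', le_div_iff₀ (Real.log_pos hL)]
  calc Real.log L * √L * Real.log L = Real.log L ^ 2 * √L := by ring
    _ ≤ (4 * √√L) ^ 2 * √L := by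
        have := (Real.log_pos hL).le
        gcongr
    _ = 16 * L := by rw [mul_pow, Real.sq_sqrt (Real.sqrt_nonneg L), mul_assoc,
        Real.mul_self_sqrt hL0]; norm_num

theorem one_add_two_mul_log_rpow_sqrt_le (hL : 1 < L) :
    (1 + 2 * Real.log L) ^ (9 * √L) ≤ Real.exp (288 * (L / Real.log L)) := by
  have hlog := Real.log_pos hL
  calc (1 + 2 * Real.log L) ^ (9 * √L) ≤ Real.exp (2 * Real.log L) ^ (9 * √L) := by
        gcongr
        linarith [Real.add_one_le_exp (2 * Real.log L)]
    _ = Real.exp (18 * (Real.log L * √L)) := by rw [← Real.exp_mul]; ring_nf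
    _ ≤ Real.exp (288 * (L / Real.log L)) :=
      Real.exp_le_exp.2 (by linarith [log_mul_sqrt_le hL])

theorem le_exp_div_log (hL : 1 < L) : L ≤ Real.exp (4 * (L / Real.log L)) := by
  have hL0 : 0 < L := by linarith
  have hlog0 := Real.log_pos hL
  have hlog : Real.log L ≤ 2 * √L := by
    have := Real.log_le_rpow_div hL0.le (by norm_num : (0 : ℝ) < 1 / 2)
    rw [Real.sqrt_eq_rpow]
    linarith
  rw [← Real.log_le_iff_le_exp hL0, mul_div_assoc', le_div_iff₀ hlog0]
  calc Real.log L * Real.log L ≤ (2 * √L) * (2 * √L) := by gcongr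
    _ = 4 * L := by rw [mul_mul_mul_comm, Real.mul_self_sqrt hL0.le]; norm_num

theorem mul_exp_pow_le_exp_exp (hL : 1 < L) {A : ℝ} {N : ℕ}
    (hN : (N : ℝ) ≤ Real.exp (A * (L / Real.log L))) :
    (2 * N * Real.exp L) ^ (2 * N) ≤ Real.exp (Real.exp ((2 * A + 6) * (L / Real.log L))) := by
  have hQ := one_le_div_log hL
  have hLQ := le_exp_div_log hL
  set Q := L / Real.log L
  have hbase : 2 * N * Real.exp L ≤ Real.exp (2 * N + L) := by
    rw [Real.exp_add]
    gcongr
    linarith [Real.add_one_le_exp (2 * N : ℝ)]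
  have hquad : (2 * N : ℝ) * (2 * N + L) ≤ 6 * (N * N * L) := by
    have hN2 : (N : ℝ) ≤ N * N := by exact_mod_cast Nat.le_mul_self N
    nlinarith [mul_nonneg (Nat.cast_nonneg (α := ℝ) N) (Nat.cast_nonneg (α := ℝ) N)]
  have hsix : 6 ≤ Real.exp (2 * Q) := by
    have : Real.exp 2 = Real.exp 1 * Real.exp 1 := by rw [← Real.exp_add]; norm_num
    have : Real.exp 2 ≤ Real.exp (2 * Q) := Real.exp_le_exp.2 (by linarith)
    nlinarith [Real.exp_one_gt_d9]
  calc (2 * N * Real.exp L) ^ (2 * N) ≤ Real.exp (2 * N + L) ^ (2 * N) := by gcongr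
    _ = Real.exp (2 * N * (2 * N + L)) := by rw [← Real.exp_nat_mul]; push_cast; rfl
    _ ≤ Real.exp (6 * (N * N * L)) := Real.exp_le_exp.2 hquad
    _ ≤ Real.exp (Real.exp (2 * Q) *
          (Real.exp (A * Q) * Real.exp (A * Q) * Real.exp (4 * Q))) := by gcongr
    _ = _ := by simp only [← Real.exp_add]; ring_nf

end LogEstimates

section GaussianIntegers

/-- The Gaussian integers whose real and imaginary parts lie in `[-x, x]`: a finite set containing
those of norm at most `x ^ 2`. -/
def gaussianBox (x : ℝ) : Finset GaussianInt :=
  (Finset.Icc (-⌊x⌋) ⌊x⌋ ×ˢ Finset.Icc (-⌊x⌋) ⌊x⌋).image fun a => ⟨a.1, a.2⟩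

theorem card_gaussianBox_le {x : ℝ} (hx : 1 ≤ x) : (#(gaussianBox x) : ℝ) ≤ 9 * x ^ 2 := by
  have hfloor : 0 ≤ ⌊x⌋ := Int.floor_nonneg.2 (by linarith)
  have hIcc : (#(Finset.Icc (-⌊x⌋) ⌊x⌋) : ℝ) = 2 * ⌊x⌋ + 1 := by
    have : (#(Finset.Icc (-⌊x⌋) ⌊x⌋) : ℤ) = 2 * ⌊x⌋ + 1 := by rw [Int.card_Icc]; lia
    exact_mod_cast this
  have : (0 : ℝ) ≤ ⌊x⌋ := by exact_mod_cast hfloor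
  calc (#(gaussianBox x) : ℝ) ≤ (2 * ⌊x⌋ + 1) ^ 2 := by
        rw [← hIcc, sq, ← Nat.cast_mul, ← Finset.card_product]
        exact Nat.cast_le.2 Finset.card_image_le
    _ ≤ (2 * x + x) ^ 2 := by
        gcongr
        exact Int.floor_le x
    _ = 9 * x ^ 2 := by ring

theorem gaussianInt_norm_eq (z : GaussianInt) : z.norm = z.re ^ 2 + z.im ^ 2 := by
  rw [Zsqrtd.norm_def]; ring

theorem mem_gaussianBox_of_norm_le_sq {z : GaussianInt} {x : ℝ} (hx : 0 ≤ x)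
    (hz : (z.norm : ℝ) ≤ x ^ 2) : z ∈ gaussianBox x := by
  rw [gaussianInt_norm_eq] at hz
  push_cast at hz
  have hbound : ∀ a : ℤ, (a : ℝ) ^ 2 ≤ x ^ 2 → a ∈ Finset.Icc (-⌊x⌋) ⌊x⌋ := fun a ha => by
    rw [Finset.mem_Icc, ← abs_le, Int.le_floor, Int.cast_abs]
    exact abs_le_of_sq_le_sq ha hx
  refine Finset.mem_image.2 ⟨(z.re, z.im), Finset.mem_product.2 ⟨?_, ?_⟩, rfl⟩
  · exact hbound _ (by nlinarith)
  · exact hbound _ (by nlinarith)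

/-- The inclusion of the Gaussian units into a finite box, which shows that they are finitely many
and bounds their number. -/
def gaussianUnitsEmbedding : GaussianIntˣ ↪ gaussianBox 1 where
  toFun u := ⟨u, mem_gaussianBox_of_norm_le_sq zero_le_one <| by
    rw [(Zsqrtd.norm_eq_one_iff' (by norm_num) _).2 u.isUnit]; norm_num⟩
  inj' _ _ h := Units.ext (congrArg Subtype.val h)

instance : Finite GaussianIntˣ := Finite.of_injective _ gaussianUnitsEmbedding.injective

theorem card_gaussianUnits_le : (Nat.card GaussianIntˣ : ℝ) ≤ 9 := by
  have hcard := Nat.card_le_card_of_injective _ gaussianUnitsEmbedding.injective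
  rw [Nat.card_eq_finsetCard] at hcard
  calc (Nat.card GaussianIntˣ : ℝ) ≤ #(gaussianBox 1) := Nat.cast_le.2 hcard
    _ ≤ 9 * 1 ^ 2 := card_gaussianBox_le le_rfl
    _ = 9 := by norm_num

/-- The norm of a Gaussian integer as a multiplicative map to `ℕ`, where, in contrast to `ℤ`,
associated elements have equal images. -/
def gaussianNorm : GaussianInt →* ℕ :=
  (Int.natAbsHom : ℤ →* ℕ).comp Zsqrtd.normMonoidHom

theorem natCast_gaussianNorm (z : GaussianInt) : (gaussianNorm z : ℤ) = z.norm :=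
  GaussianInt.abs_natCast_norm z

theorem gaussianNorm_natCast (m : ℕ) : gaussianNorm m = m ^ 2 := by
  have := natCast_gaussianNorm (m : GaussianInt)
  rw [Zsqrtd.norm_natCast, ← sq] at this
  exact_mod_cast this

theorem two_le_gaussianNorm_of_prime {p : GaussianInt} (hp : Prime p) : 2 ≤ gaussianNorm p := by
  have hpos : 0 < p.norm := GaussianInt.norm_pos.2 hp.ne_zero
  have hne : p.norm ≠ 1 := fun h => hp.not_isUnit ((Zsqrtd.norm_eq_one_iff' (by norm_num) p).1 h)
  have := natCast_gaussianNorm p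
  lia

theorem lt_sqrt_of_rpow_lt_two {L x : ℝ} (hL : 1 < L) (hx : 0 ≤ x)
    (h : x ^ (2 * Real.log 2 / Real.log L) < 2) : x < √L := by
  have hlog := Real.log_pos hL
  have := Real.log_pos one_lt_two
  have htwo : √L ^ (2 * Real.log 2 / Real.log L) = 2 := by
    have hexp : 1 / 2 * (2 * Real.log 2 / Real.log L) = Real.log 2 / Real.log L := by ring
    rw [Real.sqrt_eq_rpow, ← Real.rpow_mul (by linarith), hexp,
      Real.rpow_def_of_pos (by linarith), mul_div_cancel₀ _ hlog.ne', Real.exp_log two_pos]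
  exact (Real.rpow_lt_rpow_iff hx (Real.sqrt_nonneg L) (by positivity)).1 (h.trans_eq htwo.symm)

theorem card_le_of_forall_dvd_gaussianInt {L : ℝ} (hL : 1 < L) {w : GaussianInt} (hw : w ≠ 0)
    {S : Finset GaussianInt} (hS : ∀ z ∈ S, z ∣ w) :
    (#S : ℝ) ≤ 9 * ((1 + 2 * Real.log L) ^ (9 * √L) *
      (gaussianNorm w : ℝ) ^ (2 * Real.log 2 / Real.log L)) := by
  have hlog := Real.log_pos hL
  have hlog2 := Real.log_pos one_lt_two
  have hsqrt : 1 ≤ √√L := by simpa only [Real.one_le_sqrt] using hL.le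
  -- The exponent is the one for which the small primes are those of norm less than `√L`.
  have hsmall : ∀ p : GaussianInt, Prime p →
      (gaussianNorm p : ℝ) ^ (2 * Real.log 2 / Real.log L) < 2 → p ∈ gaussianBox √√L := by
    intro p _ hp
    refine mem_gaussianBox_of_norm_le_sq (Real.sqrt_nonneg _) ?_
    rw [Real.sq_sqrt (Real.sqrt_nonneg L), ← natCast_gaussianNorm, Int.cast_natCast]
    exact (lt_sqrt_of_rpow_lt_two hL (Nat.cast_nonneg _) hp).le
  have hbase : 1 + 1 / (2 * Real.log 2 / Real.log L * Real.log 2) ≤ 1 + 2 * Real.log L := by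
    have hcoeff : 1 / (2 * Real.log 2 / Real.log L * Real.log 2) =
        Real.log L / (2 * Real.log 2 * Real.log 2) := by field_simp
    have hfour : 1 ≤ 2 * (2 * Real.log 2 * Real.log 2) := by nlinarith [Real.log_two_gt_d9]
    rw [hcoeff, add_le_add_iff_left, div_le_iff₀ (by positivity)]
    nlinarith
  have hcard : (#(gaussianBox √√L) : ℝ) ≤ 9 * √L := by
    simpa only [Real.sq_sqrt (Real.sqrt_nonneg L)] using card_gaussianBox_le hsqrt
  refine (card_le_mul_rpow_of_forall_dvd gaussianNorm (fun _ => two_le_gaussianNorm_of_prime)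
    (by positivity) hsmall hw hS).trans ?_
  gcongr
  · exact card_gaussianUnits_le
  · rw [← Real.rpow_natCast]
    exact (Real.rpow_le_rpow (by positivity) hbase (Nat.cast_nonneg _)).trans
      (Real.rpow_le_rpow_of_exponent_le (by linarith) hcard)

theorem card_le_exp_of_norm_eq {L : ℝ} (hL : 1 < L) {m : ℕ} {S : Finset GaussianInt}
    (hS : ∀ z ∈ S, z.norm = m) :
    (#S : ℝ) ≤ Real.exp (291 * (L / Real.log L) + 3 * (Real.log m / Real.log L)) := by
  have hlog := Real.log_pos hL
  have hQ := one_le_div_log hL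
  have hm0 : 0 ≤ Real.log m := Real.log_natCast_nonneg m
  obtain rfl | hm := eq_or_ne m 0
  · have hzero : S ⊆ {0} := fun z hz => by
      simpa only [Finset.mem_singleton, Nat.cast_zero, GaussianInt.norm_eq_zero] using hS z hz
    calc (#S : ℝ) ≤ 1 := by exact_mod_cast Finset.card_le_card hzero
      _ ≤ _ := Real.one_le_exp (by positivity)
  have hdvd : ∀ z ∈ S, z ∣ (m : GaussianInt) := fun z hz =>
    ⟨star z, by rw [← Zsqrtd.norm_eq_mul_conj, hS z hz, Int.cast_natCast]⟩
  have hnine : (9 : ℝ) ≤ Real.exp (3 * (L / Real.log L)) := by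
    have hcube : (9 : ℝ) ≤ Real.exp 1 ^ 3 :=
      calc (9 : ℝ) ≤ 2.7 ^ 3 := by norm_num
        _ ≤ Real.exp 1 ^ 3 := by gcongr; linarith [Real.exp_one_gt_d9]
    rw [← Real.exp_nat_mul] at hcube
    exact hcube.trans (Real.exp_le_exp.2 (by push_cast; linarith))
  have hsmall := one_add_two_mul_log_rpow_sqrt_le hL
  have hlarge : (gaussianNorm m : ℝ) ^ (2 * Real.log 2 / Real.log L) ≤
      Real.exp (3 * (Real.log m / Real.log L)) := by
    rw [gaussianNorm_natCast, Nat.cast_pow, Real.rpow_def_of_pos (by positivity), Real.log_pow]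
    calc Real.exp ((2 : ℕ) * Real.log m * (2 * Real.log 2 / Real.log L))
        = Real.exp (4 * Real.log 2 * (Real.log m / Real.log L)) := by push_cast; ring_nf
      _ ≤ _ := by gcongr; linarith [Real.log_two_lt_d9]
  calc (#S : ℝ) ≤ _ := card_le_of_forall_dvd_gaussianInt hL (Nat.cast_ne_zero.2 hm) hdvd
    _ ≤ Real.exp (3 * (L / Real.log L)) * (Real.exp (288 * (L / Real.log L)) *
          Real.exp (3 * (Real.log m / Real.log L))) := by gcongr
    _ = _ := by simp only [← Real.exp_add]; ring_nf

/-- The identification of `ℤ²` with `ℤ[i]`, under which a frequency `(p, q)` becomes `p + q i`, of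
norm `p ^ 2 + q ^ 2`. -/
def toGaussianInt : (Fin 2 → ℤ) ↪ GaussianInt where
  toFun n := ⟨n 0, n 1⟩
  inj' n n' h := by
    rw [Zsqrtd.ext_iff] at h
    exact funext (Fin.forall_fin_two.2 h)

theorem norm_toGaussianInt_of_mem_freqSet {l : ℝ} {n : Fin 2 → ℤ} (hn : n ∈ freqSet l) :
    ((toGaussianInt n).norm : ℝ) = (l / (2 * Real.pi)) ^ 2 := by
  have hsqrt : l / (2 * Real.pi) = √((n 0 : ℝ) ^ 2 + (n 1 : ℝ) ^ 2) := by
    rw [div_eq_iff Real.two_pi_pos.ne', mul_comm]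
    exact hn.symm
  rw [hsqrt, Real.sq_sqrt (by positivity), gaussianInt_norm_eq]
  push_cast
  rfl

theorem nonneg_of_mem_freqSet {l : ℝ} {n : Fin 2 → ℤ} (hn : n ∈ freqSet l) : 0 ≤ l :=
  (mul_nonneg Real.two_pi_pos.le (Real.sqrt_nonneg _)).trans_eq hn

theorem log_sq_div_two_pi_le {K L l : ℝ} (hL : 0 ≤ L) (hl0 : 0 ≤ l) (hl : l ≤ Real.exp (K * L)) :
    Real.log ((l / (2 * Real.pi)) ^ 2) ≤ 2 * |K| * L := by
  obtain rfl | hl0 := hl0.eq_or_lt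
  · rw [zero_div, zero_pow two_ne_zero, Real.log_zero]
    positivity
  have hdiv : l / (2 * Real.pi) ≤ l := div_le_self hl0.le (by linarith [Real.pi_gt_three])
  calc Real.log ((l / (2 * Real.pi)) ^ 2) = 2 * Real.log (l / (2 * Real.pi)) := by
        rw [Real.log_pow, Nat.cast_ofNat]
    _ ≤ 2 * (K * L) := by
        gcongr
        exact (Real.log_le_iff_le_exp (by positivity)).2 (hdiv.trans hl)
    _ ≤ 2 * |K| * L := by
        rw [mul_assoc]
        gcongr
        exact le_abs_self K

theorem card_freqSet_le {K L l : ℝ} (hL : 1 < L) (hl : l ≤ Real.exp (K * L)) :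
    (#(freqSet_finite l).toFinset : ℝ) ≤ Real.exp ((291 + 6 * |K|) * (L / Real.log L)) := by
  have hlog := Real.log_pos hL
  obtain hempty | ⟨n₀, hn₀⟩ := (freqSet_finite l).toFinset.eq_empty_or_nonempty
  · rw [hempty, Finset.card_empty, Nat.cast_zero]
    positivity
  rw [Set.Finite.mem_toFinset] at hn₀
  obtain ⟨m, hm⟩ := Int.eq_ofNat_of_zero_le (GaussianInt.norm_nonneg (toGaussianInt n₀))
  have hnorm : ∀ z ∈ (freqSet_finite l).toFinset.map toGaussianInt, z.norm = m := by
    simp only [Finset.forall_mem_map, Set.Finite.mem_toFinset, ← hm]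
    intro n hn
    exact_mod_cast (norm_toGaussianInt_of_mem_freqSet hn).trans
      (norm_toGaussianInt_of_mem_freqSet hn₀).symm
  have hlogm : Real.log m ≤ 2 * |K| * L := by
    rw [← Int.cast_natCast (R := ℝ) m, ← hm,
      norm_toGaussianInt_of_mem_freqSet hn₀]
    exact log_sq_div_two_pi_le (by linarith) (nonneg_of_mem_freqSet hn₀) hl
  rw [← Finset.card_map toGaussianInt]
  refine (card_le_exp_of_norm_eq hL hnorm).trans (Real.exp_le_exp.2 ?_)
  have : Real.log m / Real.log L ≤ 2 * |K| * (L / Real.log L) := by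
    rw [mul_div_assoc']
    gcongr
  linarith

end GaussianIntegers

section SmallTranslates

theorem translate_sub_mul_add_sum_insert {G ι : Type*} [AddMonoid G] [DecidableEq ι]
    (ψ : AddChar G Circle) (χ : ι → AddChar G Circle) {S : Finset ι} {j : ι} (hj : j ∉ S) (a : ℂ)
    (c : ι → ℂ) (x h : G) :
    a * ψ (x + h) + ∑ i ∈ insert j S, c i * χ i (x + h) -
        χ j h * (a * ψ x + ∑ i ∈ insert j S, c i * χ i x) =
      a * (ψ h - χ j h) * ψ x + ∑ i ∈ S, c i * (χ i h - χ j h) * χ i x := by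
  have hsum : ∑ i ∈ S, c i * (χ i h - χ j h) * (χ i x : ℂ) =
      ∑ i ∈ S, c i * (χ i x * χ i h) - χ j h * ∑ i ∈ S, c i * χ i x := by
    rw [Finset.mul_sum, ← Finset.sum_sub_distrib]
    exact Finset.sum_congr rfl fun i _ => by ring
  simp only [Finset.sum_insert hj, AddChar.map_add_eq_mul, Circle.coe_mul, hsum]
  ring

variable {G : Type*} [AddGroup G] [MeasurableSpace G] [MeasurableAdd G] {μ : Measure G}
  [μ.IsAddRightInvariant] {p : ℝ≥0∞}

theorem eLpNorm_translate_sub_mul_le (hp : 1 ≤ p) (w : Circle) {f : G → ℂ} {A B : Set G} {h : G}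
    (hf : AEStronglyMeasurable f (μ.restrict B)) (hAB : A ⊆ B) (hA : ∀ x ∈ A, x + h ∈ B) :
    eLpNorm (fun x => f (x + h) - w * f x) p (μ.restrict A) ≤
      2 * eLpNorm f p (μ.restrict B) := by
  have hpres : MeasurePreserving (· + h) (μ.restrict ((· + h) ⁻¹' B)) (μ.restrict B) :=
    (measurePreserving_add_right μ h).restrict_preimage_emb
      (MeasurableEquiv.addRight h).measurableEmbedding B
  have hrestrict : μ.restrict A ≤ μ.restrict ((· + h) ⁻¹' B) := Measure.restrict_mono_set μ hA
  have htranslate : eLpNorm (fun x => f (x + h)) p (μ.restrict A) ≤ eLpNorm f p (μ.restrict B) :=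
    (eLpNorm_mono_measure _ hrestrict).trans_eq (eLpNorm_comp_measurePreserving hf hpres)
  have hrotate : eLpNorm (fun x => (w : ℂ) * f x) p (μ.restrict A) ≤ eLpNorm f p (μ.restrict B) :=
    (eLpNorm_congr_norm_ae (.of_forall fun x => by
      rw [norm_mul, Circle.norm_coe, one_mul])).trans_le
      (eLpNorm_mono_measure f (Measure.restrict_mono_set μ hAB))
  have hfA := hf.mono_measure (Measure.restrict_mono_set μ hAB)
  calc eLpNorm (fun x => f (x + h) - w * f x) p (μ.restrict A)
      ≤ eLpNorm (fun x => f (x + h)) p (μ.restrict A) +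
          eLpNorm (fun x => (w : ℂ) * f x) p (μ.restrict A) :=
        eLpNorm_sub_le ((hf.comp_measurePreserving hpres).mono_measure hrestrict)
          (hfA.const_mul _) hp
    _ ≤ 2 * eLpNorm f p (μ.restrict B) := by
        rw [two_mul]
        exact add_le_add htranslate hrotate

theorem enorm_mul_eLpNorm_le_eLpNorm_add_sum (hp : 1 ≤ p) (q : AddGroupSeminorm G) {δ : ℝ}
    {κ : ℝ≥0∞} {ι : Type*} {χ : ι → AddChar G Circle} {ψ : AddChar G Circle}
    (hψ : Measurable fun x => (ψ x : ℂ)) {S : Finset ι}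
    (hχ : ∀ i ∈ S, Measurable fun x => (χ i x : ℂ))
    (hsep : ∀ i ∈ S, ∃ h, q h ≤ δ ∧ 2 * κ ≤ ‖(ψ h - χ i h : ℂ)‖ₑ) (a : ℂ) (c : ι → ℂ) (r : ℝ) :
    ‖a‖ₑ * κ ^ #S * eLpNorm (fun _ : G => (1 : ℂ)) p (μ.restrict {x | q x < r}) ≤
      eLpNorm (fun x => a * ψ x + ∑ i ∈ S, c i * χ i x) p (μ.restrict {x | q x < r + #S * δ}) := by
  classical
  induction S using Finset.induction_on generalizing a c with
  | empty =>
    have hnorm : eLpNorm (fun x => a * (ψ x : ℂ)) p (μ.restrict {x | q x < r}) =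
        eLpNorm (a • fun _ : G => (1 : ℂ)) p (μ.restrict {x | q x < r}) :=
      eLpNorm_congr_norm_ae (.of_forall fun x => by simp [Circle.norm_coe])
    simp [hnorm, eLpNorm_const_smul]
  | insert j S hj ih =>
    obtain ⟨h, hqh, hκ⟩ := hsep j (Finset.mem_insert_self j S)
    set f : G → ℂ := fun x => a * ψ x + ∑ i ∈ insert j S, c i * χ i x with hf
    have hfm : Measurable f := (hψ.const_mul a).add <|
      Finset.measurable_fun_sum _ fun i hi => (hχ i hi).const_mul (c i)
    have hδ : 0 ≤ δ := (apply_nonneg q h).trans hqh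
    have hsub : ∀ x, q x < r + #S * δ → q x < r + ↑(#S + 1) * δ := fun x hx =>
      hx.trans_le (by gcongr; exact Nat.le_succ _)
    have hadd : ∀ x, q x < r + #S * δ → q (x + h) < r + ↑(#S + 1) * δ := fun x hx =>
      calc q (x + h) ≤ q x + q h := map_add_le_add q x h
        _ < r + #S * δ + δ := add_lt_add_of_lt_of_le hx hqh
        _ = r + ↑(#S + 1) * δ := by push_cast; ring
    have hstep := eLpNorm_translate_sub_mul_le hp (χ j h) hfm.aestronglyMeasurable.restrict hsub
      (μ := μ) hadd
    simp only [hf, translate_sub_mul_add_sum_insert ψ χ hj] at hstep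
    have hih := ih (fun i hi => hχ i (Finset.mem_insert_of_mem hi))
      (fun i hi => hsep i (Finset.mem_insert_of_mem hi)) (a * (ψ h - χ j h))
      (fun i => c i * (χ i h - χ j h))
    rw [Finset.card_insert_of_notMem hj]
    refine (ENNReal.mul_le_mul_iff_right two_ne_zero ENNReal.ofNat_ne_top).1 ?_
    calc 2 * (‖a‖ₑ * κ ^ (#S + 1) * eLpNorm (fun _ : G => (1 : ℂ)) p (μ.restrict {x | q x < r}))
        = ‖a‖ₑ * (2 * κ) * κ ^ #S *
            eLpNorm (fun _ : G => (1 : ℂ)) p (μ.restrict {x | q x < r}) := by ring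
      _ ≤ ‖a * (ψ h - χ j h)‖ₑ * κ ^ #S *
            eLpNorm (fun _ : G => (1 : ℂ)) p (μ.restrict {x | q x < r}) := by
          rw [enorm_mul]
          gcongr
      _ ≤ 2 * eLpNorm f p (μ.restrict {x | q x < r + ↑(#S + 1) * δ}) := hih.trans hstep

end SmallTranslates

section TrigonometricPolynomials

variable {d : Type*} [Fintype d]

/-- The distance to the origin in the flat metric of `ℝ^d / ℤ^d`, as a seminorm on the group. It is
the Euclidean norm of the distances of the coordinates to the nearest integer. -/
def flatNorm (d : Type*) [Fintype d] : AddGroupSeminorm (UnitAddTorus d) where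
  toFun x := ‖WithLp.toLp 2 x‖
  map_zero' := by rw [WithLp.toLp_zero, norm_zero]
  add_le' x y := norm_add_le (WithLp.toLp 2 x) (WithLp.toLp 2 y)
  neg' x := norm_neg (WithLp.toLp 2 x)

/-- The exponential `x ↦ exp (2πi n·x)`, as a character of the torus with values in the unit circle;
this is the function `UnitAddTorus.mFourier n`. -/
def torusChar (n : d → ℤ) : AddChar (UnitAddTorus d) Circle where
  toFun x := ∏ i, (n i • x i).toCircle
  map_zero_eq_one' := by
    simp only [Pi.zero_apply, smul_zero, AddCircle.toCircle_zero, Finset.prod_const_one]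
  map_add_eq_mul' x y := by
    simp only [Pi.add_apply, smul_add, AddCircle.toCircle_add, Finset.prod_mul_distrib]

theorem mFourier_eq_torusChar (n : d → ℤ) (x : UnitAddTorus d) :
    UnitAddTorus.mFourier n x = torusChar n x :=
  (map_prod Circle.coeHom (fun i => (n i • x i).toCircle) Finset.univ).symm

theorem torusChar_sub (n m : d → ℤ) (x : UnitAddTorus d) :
    torusChar (n - m) x = torusChar n x / torusChar m x :=
  calc torusChar (n - m) x = ∏ i, (n i • x i).toCircle / (m i • x i).toCircle :=
        Finset.prod_congr rfl fun i _ => by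
          rw [Pi.sub_apply, sub_smul, sub_eq_add_neg, AddCircle.toCircle_add,
            AddCircle.toCircle_neg, div_eq_mul_inv]
    _ = torusChar n x / torusChar m x := Finset.prod_div_distrib ..

theorem torusChar_single [DecidableEq d] (n : d → ℤ) (i : d) (t : UnitAddCircle) :
    (torusChar n (Pi.single i t) : ℂ) = fourier (n i) t := by
  have hprod : torusChar n (Pi.single i t) =
      (n i • (Pi.single i t : UnitAddTorus d) i).toCircle :=
    Finset.prod_eq_single i
      (fun j _ hj => by rw [Pi.single_eq_of_ne hj, smul_zero, AddCircle.toCircle_zero])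
      fun hi => absurd (Finset.mem_univ i) hi
  rw [hprod, Pi.single_eq_same, fourier_apply]

theorem norm_fourier_sub_one (k : ℤ) (t : ℝ) :
    ‖fourier k (t : UnitAddCircle) - 1‖ = 2 * |Real.sin (Real.pi * (k * t))| := by
  have harg : 2 * (Real.pi : ℂ) * Complex.I * k * t / (1 : ℝ) =
      Complex.I * ((2 * (Real.pi * (k * t)) : ℝ) : ℂ) := by
    push_cast
    ring
  rw [fourier_coe_apply, harg, Complex.norm_exp_I_mul_ofReal_sub_one,
    mul_div_cancel_left₀ _ two_ne_zero, norm_mul, Real.norm_eq_abs, Real.norm_eq_abs, abs_two]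

theorem four_mul_le_norm_fourier_sub_one {k : ℤ} {t : ℝ} (hkt : |(k : ℝ)| * |t| ≤ 1 / 2) :
    4 * (|(k : ℝ)| * |t|) ≤ ‖fourier k (t : UnitAddCircle) - 1‖ := by
  have hpi := Real.pi_pos
  have habs : |Real.pi * (k * t)| = Real.pi * (|(k : ℝ)| * |t|) := by
    rw [abs_mul, abs_mul, abs_of_pos hpi]
  have hsin : 2 * (|(k : ℝ)| * |t|) ≤ |Real.sin (Real.pi * (k * t))| :=
    calc 2 * (|(k : ℝ)| * |t|) = 2 / Real.pi * |Real.pi * (k * t)| := by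
          rw [habs]
          field_simp
      _ ≤ |Real.sin (Real.pi * (k * t))| := Real.mul_abs_le_abs_sin (by rw [habs]; nlinarith)
  rw [norm_fourier_sub_one]
  linarith

theorem exists_abs_le_four_mul_le_norm_fourier_sub_one {k : ℤ} (hk : k ≠ 0) {δ : ℝ} (hδ : 0 < δ)
    (hδ' : δ ≤ 1 / 2) : ∃ t : ℝ, |t| ≤ δ ∧ 4 * δ ≤ ‖fourier k (t : UnitAddCircle) - 1‖ := by
  have hk1 : 1 ≤ |(k : ℝ)| := by exact_mod_cast Int.one_le_abs hk
  set t := min δ (1 / (2 * |(k : ℝ)|)) with ht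
  have ht0 : 0 < t := lt_min hδ (by positivity)
  have hkt : |(k : ℝ)| * |t| = min (|(k : ℝ)| * δ) (1 / 2) := by
    rw [abs_of_pos ht0, ht, mul_min_of_nonneg _ _ (abs_nonneg _)]
    congr 1
    field_simp
  have hlow : δ ≤ |(k : ℝ)| * |t| := hkt ▸ le_min (le_mul_of_one_le_left hδ.le hk1) hδ'
  have hup : |(k : ℝ)| * |t| ≤ 1 / 2 := hkt ▸ min_le_right _ _
  exact ⟨t, (abs_of_pos ht0).trans_le (min_le_left _ _),
    (by gcongr : 4 * δ ≤ 4 * (|(k : ℝ)| * |t|)).trans (four_mul_le_norm_fourier_sub_one hup)⟩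

theorem exists_flatNorm_le_four_mul_le_norm_torusChar_sub {n m : d → ℤ} (hnm : n ≠ m) {δ : ℝ}
    (hδ : 0 < δ) (hδ' : δ ≤ 1 / 2) :
    ∃ h, flatNorm d h ≤ δ ∧ 4 * δ ≤ ‖(torusChar n h - torusChar m h : ℂ)‖ := by
  classical
  obtain ⟨i, hi⟩ := Function.ne_iff.1 hnm
  obtain ⟨t, ht, hk⟩ := exists_abs_le_four_mul_le_norm_fourier_sub_one (sub_ne_zero.2 hi) hδ hδ'
  refine ⟨Pi.single i (t : UnitAddCircle), ?_, ?_⟩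
  · calc flatNorm d (Pi.single i (t : UnitAddCircle)) = ‖(t : UnitAddCircle)‖ :=
          PiLp.norm_single 2 (fun _ => UnitAddCircle) i _
      _ ≤ δ := QuotientAddGroup.norm_mk_le_norm.trans ht
  · have hfactor : ∀ z w : Circle, ‖((z / w : Circle) : ℂ) - 1‖ = ‖(z - w : ℂ)‖ := fun z w => by
      rw [Circle.coe_div, div_sub_one w.coe_ne_zero, norm_div, Circle.norm_coe, div_one]
    rwa [← Pi.sub_apply, ← torusChar_single, torusChar_sub, hfactor] at hk

/-- The trigonometric polynomial with frequencies in `S` and coefficients `c`. The values of `c`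
outside `S` are irrelevant. -/
def trigPoly (S : Finset (d → ℤ)) (c : (d → ℤ) → ℂ) (x : UnitAddTorus d) : ℂ :=
  ∑ n ∈ S, c n * UnitAddTorus.mFourier n x

theorem volume_univ_unitAddTorus : (volume : Measure (UnitAddTorus d)) Set.univ = 1 := by
  rw [← Set.pi_univ Set.univ, volume_pi_pi]
  simp only [AddCircle.measure_univ, ENNReal.ofReal_one, Finset.prod_const_one]

variable {p : ℝ≥0∞}

theorem eLpNorm_trigPoly_le_sum (hp : 1 ≤ p) (S : Finset (d → ℤ)) (c : (d → ℤ) → ℂ) :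
    eLpNorm (trigPoly S c) p volume ≤ ∑ n ∈ S, ‖c n‖ₑ := by
  have hterm : ∀ n, eLpNorm (fun x : UnitAddTorus d => c n * UnitAddTorus.mFourier n x) p volume ≤
      ‖c n‖ₑ := fun n => by
    refine (eLpNorm_le_of_ae_bound (C := ‖c n‖) (.of_forall fun x => ?_)).trans_eq ?_
    · rw [norm_mul, mFourier_eq_torusChar, Circle.norm_coe, mul_one]
    · rw [volume_univ_unitAddTorus, ENNReal.one_rpow, one_mul, ofReal_norm]
  have hsum : trigPoly S c = ∑ n ∈ S, fun x => c n * UnitAddTorus.mFourier n x := by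
    ext x
    rw [trigPoly, Finset.sum_apply]
  rw [hsum]
  refine (eLpNorm_sum_le (fun n _ => ?_) hp).trans (Finset.sum_le_sum fun n _ => hterm n)
  exact (by fun_prop : Continuous fun x => c n * UnitAddTorus.mFourier n x).aestronglyMeasurable

theorem enorm_coeff_mul_le_eLpNorm_trigPoly (hp : 1 ≤ p) {δ : ℝ} (hδ : 0 < δ) (hδ' : δ ≤ 1 / 2)
    {S : Finset (d → ℤ)} (c : (d → ℤ) → ℂ) (r : ℝ) {n : d → ℤ} (hn : n ∈ S) :
    ‖c n‖ₑ * ENNReal.ofReal (2 * δ) ^ (#S - 1) *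
        eLpNorm (fun _ => (1 : ℂ)) p (volume.restrict {x | flatNorm d x < r}) ≤
      eLpNorm (trigPoly S c) p (volume.restrict {x | flatNorm d x < r + #S * δ}) := by
  classical
  have hmeas : ∀ m : d → ℤ, Measurable fun x => (torusChar m x : ℂ) := fun m => by
    simp only [← mFourier_eq_torusChar]
    exact (UnitAddTorus.mFourier m).continuous.measurable
  have hsep : ∀ m ∈ S.erase n, ∃ h, flatNorm d h ≤ δ ∧
      2 * ENNReal.ofReal (2 * δ) ≤ ‖(torusChar n h - torusChar m h : ℂ)‖ₑ := fun m hm => by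
    obtain ⟨h, hhδ, hsep⟩ :=
      exists_flatNorm_le_four_mul_le_norm_torusChar_sub (Finset.ne_of_mem_erase hm).symm hδ hδ'
    refine ⟨h, hhδ, ?_⟩
    rw [← ofReal_norm, ← ENNReal.ofReal_ofNat 2, ← ENNReal.ofReal_mul zero_le_two]
    exact ENNReal.ofReal_le_ofReal (by linarith)
  have hpoly : trigPoly S c =
      fun x => c n * torusChar n x + ∑ m ∈ S.erase n, c m * torusChar m x := by
    ext x
    simp only [trigPoly, mFourier_eq_torusChar]
    exact (Finset.add_sum_erase S (fun m => c m * (torusChar m x : ℂ)) hn).symm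
  have hkey := enorm_mul_eLpNorm_le_eLpNorm_add_sum (μ := volume) hp (flatNorm d) (hmeas n)
    (fun m _ => hmeas m) hsep (c n) c r
  rw [← hpoly, Finset.card_erase_of_mem hn] at hkey
  have hball : ∀ x, flatNorm d x < r + ↑(#S - 1) * δ → flatNorm d x < r + #S * δ := fun x hx =>
    hx.trans_le (by gcongr; exact Nat.sub_le _ _)
  exact hkey.trans (eLpNorm_mono_measure _ (Measure.restrict_mono_set _ hball))

theorem eLpNorm_trigPoly_mul_le (hp : 1 ≤ p) {δ : ℝ} (hδ : 0 < δ) (hδ' : δ ≤ 1 / 2)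
    (S : Finset (d → ℤ)) (c : (d → ℤ) → ℂ) (r : ℝ) :
    eLpNorm (trigPoly S c) p volume * (ENNReal.ofReal (2 * δ) ^ (#S - 1) *
        eLpNorm (fun _ => (1 : ℂ)) p (volume.restrict {x | flatNorm d x < r})) ≤
      #S * eLpNorm (trigPoly S c) p (volume.restrict {x | flatNorm d x < r + #S * δ}) := by
  refine (mul_le_mul_left (eLpNorm_trigPoly_le_sum hp S c) _).trans ?_
  rw [Finset.sum_mul, ← nsmul_eq_mul]
  refine Finset.sum_le_card_nsmul _ _ _ fun n hn => ?_
  rw [← mul_assoc]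
  exact enorm_coeff_mul_le_eLpNorm_trigPoly hp hδ hδ' c r hn

end TrigonometricPolynomials

section SpectralProjector

theorem smallBall_eq (r : ℝ) : smallBall r = {x | flatNorm (Fin 2) x < r} := by
  ext x
  have hnorm : flatNorm (Fin 2) x = √(‖x 0‖ ^ 2 + ‖x 1‖ ^ 2) := by
    rw [← Fin.sum_univ_two fun i => ‖x i‖ ^ 2]
    exact PiLp.norm_eq_of_L2 (WithLp.toLp 2 x)
  rw [Set.mem_ofPred_eq, hnorm]
  rfl

theorem sq_le_volume_smallBall {r : ℝ} (hr : 0 < r) (hr1 : r ≤ 1) :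
    ENNReal.ofReal r ^ 2 ≤ volume (smallBall r) := by
  have hsub : Set.univ.pi (fun _ : Fin 2 => Metric.closedBall (0 : UnitAddCircle) (r / 2)) ⊆
      smallBall r := fun x hx => by
    have hcoord : ∀ i, ‖x i‖ ≤ r / 2 := fun i => mem_closedBall_zero_iff.1 (hx i (Set.mem_univ i))
    exact (Real.sqrt_lt' hr).2 (by
      nlinarith [norm_nonneg (x 0), norm_nonneg (x 1), hcoord 0, hcoord 1])
  refine le_trans (le_of_eq ?_) (measure_mono hsub)
  rw [volume_pi_pi, Finset.prod_const, Finset.card_univ, Fintype.card_fin,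
    AddCircle.volume_closedBall, mul_div_cancel₀ r two_ne_zero, min_eq_right hr1]

theorem ofReal_le_eLpNorm_one_smallBall {r : ℝ} (hr : 0 < r) (hr1 : r ≤ 1) :
    ENNReal.ofReal r ≤ eLpNorm (fun _ => (1 : ℂ)) 2 (volume.restrict (smallBall r)) := by
  have hvol := sq_le_volume_smallBall hr hr1
  have hne : (volume : Measure Torus).restrict (smallBall r) ≠ 0 := by
    rw [Ne, Measure.restrict_eq_zero]
    exact ((ENNReal.pow_pos (ENNReal.ofReal_pos.2 hr) 2).trans_le hvol).ne'
  calc ENNReal.ofReal r = (ENNReal.ofReal r ^ 2) ^ (1 / 2 : ℝ) := by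
        rw [← ENNReal.rpow_natCast, ← ENNReal.rpow_mul]
        norm_num
    _ ≤ volume (smallBall r) ^ (1 / 2 : ℝ) := by gcongr
    _ = _ := by
        rw [eLpNorm_const _ two_ne_zero hne, Measure.restrict_apply_univ, enorm_one, one_mul,
          ENNReal.toReal_ofNat]

theorem eLpNorm_trigPoly_mul_le_smallBall {ε : ℝ} (hε : 0 < ε) (hε1 : ε ≤ 1)
    (S : Finset (Fin 2 → ℤ)) (c : (Fin 2 → ℤ) → ℂ) :
    eLpNorm (trigPoly S c) 2 volume * ENNReal.ofReal (ε / (2 * #S)) ^ #S ≤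
      eLpNorm (trigPoly S c) 2 (volume.restrict (smallBall ε)) := by
  obtain rfl | hS := S.eq_empty_or_nonempty
  · have hzero : trigPoly (∅ : Finset (Fin 2 → ℤ)) c = 0 := funext fun x => Finset.sum_empty
    rw [hzero, eLpNorm_zero, eLpNorm_zero, zero_mul]
  have hS1 : (1 : ℝ) ≤ #S := by exact_mod_cast hS.card_pos
  set δ := ε / (2 * #S) with hδ_def
  have hδ : 0 < δ := by positivity
  have hSδ : #S * δ = ε / 2 := by
    rw [hδ_def]
    field_simp
  have hkey := eLpNorm_trigPoly_mul_le (p := 2) one_le_two hδ (by nlinarith) S c (ε / 2)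
  rw [← smallBall_eq, ← smallBall_eq, hSδ, add_halves] at hkey
  have hfactor : #S * ENNReal.ofReal δ ^ #S ≤ ENNReal.ofReal (2 * δ) ^ (#S - 1) *
      eLpNorm (fun _ => (1 : ℂ)) 2 (volume.restrict (smallBall (ε / 2))) :=
    calc #S * ENNReal.ofReal δ ^ #S = ENNReal.ofReal δ ^ (#S - 1) * ENNReal.ofReal (#S * δ) := by
          rw [ENNReal.ofReal_mul (Nat.cast_nonneg _), ENNReal.ofReal_natCast, mul_left_comm,
            pow_sub_one_mul hS.card_ne_zero]
      _ ≤ _ := by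
          rw [hSδ]
          gcongr
          · linarith
          · exact ofReal_le_eLpNorm_one_smallBall (half_pos hε) (by linarith)
  refine (ENNReal.mul_le_mul_iff_right (Nat.cast_ne_zero.2 hS.card_ne_zero)
    (ENNReal.natCast_ne_top #S)).1 ?_
  rw [mul_left_comm]
  exact (mul_le_mul_right hfactor _).trans hkey

theorem specProj_ae_eq (l : ℝ) (u : L2Torus) :
    specProj l u =ᵐ[volume]
      trigPoly (freqSet_finite l).toFinset fun n => inner ℂ (expMode n) u := by
  have hterm : ∀ᵐ x ∂(volume : Measure Torus), ∀ n ∈ (freqSet_finite l).toFinset,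
      (inner ℂ (expMode n) u • expMode n : L2Torus) x =
        inner ℂ (expMode n) u * UnitAddTorus.mFourier n x := by
    rw [Finset.eventually_all]
    intro n _
    filter_upwards [Lp.coeFn_smul (inner ℂ (expMode n) u) (expMode n),
      ContinuousMap.coeFn_toLp (p := 2) (𝕜 := ℂ) (volume : Measure Torus) (UnitAddTorus.mFourier n)]
      with x hsmul hmode
    rw [hsmul, Pi.smul_apply, smul_eq_mul, expMode, hmode]
  filter_upwards [Lp.coeFn_finsetSum (freqSet_finite l).toFinset
    (fun n => (inner ℂ (expMode n) u • expMode n : L2Torus)), hterm] with x hsum hx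
  rw [specProj, hsum, Finset.sum_apply]
  exact Finset.sum_congr rfl hx

theorem toReal_eLpNorm_two_sq {α : Type*} [MeasurableSpace α] {E : Type*} [NormedAddCommGroup E]
    {μ : Measure α} {f : α → E} (hf : MemLp f 2 μ) :
    (eLpNorm f 2 μ).toReal ^ 2 = ∫ x, ‖f x‖ ^ 2 ∂μ := by
  have hint : 0 ≤ ∫ x, ‖f x‖ ^ 2 ∂μ := integral_nonneg fun x => sq_nonneg ‖f x‖
  rw [hf.eLpNorm_eq_integral_rpow_norm two_ne_zero ENNReal.ofNat_ne_top, ENNReal.toReal_ofNat]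
  simp only [Real.rpow_two]
  rw [ENNReal.toReal_ofReal (by positivity), ← Real.rpow_natCast, ← Real.rpow_mul hint]
  norm_num

theorem norm_specProj_mul_le (l : ℝ) (u : L2Torus) {ε : ℝ} (hε : 0 < ε) (hε1 : ε ≤ 1) :
    ‖specProj l u‖ * (ε / (2 * #(freqSet_finite l).toFinset)) ^ #(freqSet_finite l).toFinset ≤
      (eLpNorm (specProj l u) 2 (volume.restrict (smallBall ε))).toReal := by
  have hae := specProj_ae_eq l u
  have hfinite : eLpNorm (specProj l u) 2 (volume.restrict (smallBall ε)) ≠ ∞ :=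
    ((Lp.memLp (specProj l u)).restrict _).eLpNorm_ne_top
  have hkey := eLpNorm_trigPoly_mul_le_smallBall hε hε1 (freqSet_finite l).toFinset
    fun n => inner ℂ (expMode n) u
  rw [← eLpNorm_congr_ae hae, ← eLpNorm_congr_ae (ae_restrict_of_ae hae)] at hkey
  have hreal := ENNReal.toReal_mono hfinite hkey
  rwa [ENNReal.toReal_mul, ENNReal.toReal_pow, ENNReal.toReal_ofReal (by positivity),
    ← Lp.norm_def] at hreal

theorem norm_specProj_sq_le (l : ℝ) (u : L2Torus) {ε : ℝ} (hε : 0 < ε) (hε1 : ε ≤ 1) :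
    ‖specProj l u‖ ^ 2 ≤
      (2 * #(freqSet_finite l).toFinset * ε⁻¹) ^ (2 * #(freqSet_finite l).toFinset) *
        ∫ x in smallBall ε, ‖specProj l u x‖ ^ 2 := by
  have hmul := norm_specProj_mul_le l u hε hε1
  set N := #(freqSet_finite l).toFinset
  have hpos : 0 < (ε / (2 * N)) ^ N := by
    obtain hN | hN := N.eq_zero_or_pos
    · rw [hN, pow_zero]
      exact one_pos
    · positivity
  have hinv : ((ε / (2 * N)) ^ N)⁻¹ = (2 * N * ε⁻¹) ^ N := by
    rw [← inv_pow, inv_div, div_eq_mul_inv]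
  calc ‖specProj l u‖ ^ 2
      ≤ ((2 * N * ε⁻¹) ^ N *
          (eLpNorm (specProj l u) 2 (volume.restrict (smallBall ε))).toReal) ^ 2 := by
        gcongr
        rwa [← hinv, le_inv_mul_iff₀ hpos, mul_comm]
    _ = (2 * N * ε⁻¹) ^ (2 * N) * ∫ x in smallBall ε, ‖specProj l u x‖ ^ 2 := by
        rw [mul_pow, ← pow_mul, mul_comm N 2,
          toReal_eLpNorm_two_sq ((Lp.memLp (specProj l u)).restrict _)]

end SpectralProjector

end

end TorusLowFreq

theorem mainTheorem7_general (K : ℝ) :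
    ∃ C : ℝ, 0 < C ∧ ∀ ε : ℝ, 0 < ε → ε < Real.exp (-1) →
      ∀ l : ℝ, l ≤ ε ^ (-K) → ∀ u₀ : TorusLowFreq.L2Torus,
        ‖TorusLowFreq.specProj l u₀‖ ^ 2 ≤
          Real.exp (Real.exp (C * Real.log ε⁻¹ / Real.log (Real.log ε⁻¹))) *
            ∫ x in TorusLowFreq.smallBall ε, ‖TorusLowFreq.specProj l u₀ x‖ ^ 2 := by
  refine ⟨2 * (291 + 6 * |K|) + 6, by positivity, fun ε hε hε1 l hl u₀ => ?_⟩
  obtain ⟨L, rfl⟩ : ∃ L, ε = Real.exp (-L) := ⟨-Real.log ε, by rw [neg_neg, Real.exp_log hε]⟩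
  have hL : 1 < L := neg_lt_neg_iff.1 (Real.exp_lt_exp.1 hε1)
  have hl' : l ≤ Real.exp (K * L) := by rwa [← Real.exp_mul, neg_mul_neg, mul_comm] at hl
  have hcard := TorusLowFreq.card_freqSet_le hL hl'
  have hproj := TorusLowFreq.norm_specProj_sq_le l u₀ hε (Real.exp_le_one_iff.2 (by linarith))
  rw [← Real.exp_neg, neg_neg] at hproj ⊢
  rw [Real.log_exp, mul_div_assoc]
  refine hproj.trans (mul_le_mul_of_nonneg_right
    (TorusLowFreq.mul_exp_pow_le_exp_exp hL hcard) ?_)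
  exact MeasureTheory.integral_nonneg fun x => sq_nonneg _

theorem mainTheorem7 :
    ∃ C : ℝ, 0 < C ∧ ∀ ε : ℝ, 0 < ε → ε < Real.exp (-1) →
      ∀ l : ℝ, l ≤ ε ^ (-17 : ℤ) → ∀ u₀ : TorusLowFreq.L2Torus,
        ‖TorusLowFreq.specProj l u₀‖ ^ 2 ≤
          Real.exp (Real.exp (C * Real.log ε⁻¹ / Real.log (Real.log ε⁻¹))) *
            ∫ x in TorusLowFreq.smallBall ε, ‖TorusLowFreq.specProj l u₀ x‖ ^ 2 := by
  simpa only [← Real.rpow_intCast, Int.cast_neg, Int.cast_ofNat] using mainTheorem7_general 17
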